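/- Let $q$ be a prime power and $C_2\subseteq C_1\subseteq\mathbf F_q^n$ linear codes. For $1\le t\le \dim C_1-\dim C_2$ the $t$-th relative generalized Hamming weight is $$M_t(C_1,C_2)=\min\{|I| : I\subseteq\{1,\dots,n\},\ \dim(C_1\cap V_I)-\dim(C_2\cap V_I)\ge t\},$$ where $V_I=\{x\in\mathbf F_q^n : x_i=0 \text{ for all } i\notin I\}$. For a real number $T$ let $A_n(T,R_1,R_2)$ be the set of all $d/n$, $d\in\mathbf Z_{\ge0}$, for which there are linear codes $C_2\subseteq C_1\subseteq \mathbf F_q^n$ with $\dim C_1\ge nR_1$, $\dim C_2\le nR_2$ and an integer $t$ with $1\le t\le\dim C_1-\dim C_2$, $t\le T$ and $M_t(C_1,C_2)\ge d$. Put $$\delta_q(\tau,R_1,R_2)=\limsup_{n\to\infty}\,\max A_n(n\tau,R_1,R_2),\qquad \delta_q^{+}(\tau,R_1,R_2)=\limsup_{n\to\infty}\,\max A_n(\max\{1,n\tau\},R_1,R_2)$$ (with $\max\emptyset=-\infty$). Thus $\delta_q^+$ always allows $t=1$; for $\tau>0$ the two definitions agree, since $\max\{1,n\tau\}=n\tau$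 for large $n$, while for $\tau=0$ no $t\ge1$ satisfies $t\le n\tau$ and $\delta_q^+$ replaces $\delta_q$. Let $0\le\tau\le R_1\le1$ and $R_2\ge0$. Then: (a) if $\tau>0$, then $\delta_q(\tau,R_1,R_2)=1+\tau-R_1$; (b) if $\tau>0$ or $\tau=R_1-R_2$ (including $\tau=0$, $R_1=R_2$), then $\delta_q^{+}(\tau,R_1,R_2)=1+\tau-R_1$. -/

import Mathlib

namespace RelGHW

/-- `V_I`: the vectors of `F ^ n` that vanish outside the index set `I`. -/
def coordSubspace (F : Type*) [Field F] {n : ℕ} (I : Finset (Fin n)) :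
    Submodule F (Fin n → F) where
  carrier := {x | ∀ i, i ∉ I → x i = 0}
  add_mem' := by
    intro x y hx hy i hi
    simp [hx i hi, hy i hi]
  zero_mem' := by
    intro i _
    rfl
  smul_mem' := by
    intro c x hx i hi
    simp [hx i hi]

/-- The index sets `I` with `dim (C₁ ∩ V_I) - dim (C₂ ∩ V_I) ≥ t` (a difference of integers,
written without subtraction). -/
def RGHWAdmissible {F : Type*} [Field F] {n : ℕ} (C₁ C₂ : Submodule F (Fin n → F)) (t : ℕ)
    (I : Finset (Fin n)) : Prop :=
  Module.finrank F ↥(C₂ ⊓ coordSubspace F I) + t ≤ Module.finrank F ↥(C₁ ⊓ coordSubspace F I)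

/-- The `t`-th relative generalized Hamming weight `M_t(C₁, C₂)` of `C₂ ⊆ C₁ ⊆ F ^ n`:
the least size of an admissible index set. It is used only for `t ≤ dim C₁ - dim C₂`, where
the minimum is over a nonempty family, see `rghw_isLeast`. -/
noncomputable def rghw {F : Type*} [Field F] {n : ℕ} (C₁ C₂ : Submodule F (Fin n → F))
    (t : ℕ) : ℕ :=
  sInf {m | ∃ I : Finset (Fin n), RGHWAdmissible C₁ C₂ t I ∧ I.card = m}

theorem rghw_isLeast {F : Type*} [Field F] {n : ℕ} (C₁ C₂ : Submodule F (Fin n → F)) (t : ℕ)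
    (h : Module.finrank F C₂ + t ≤ Module.finrank F C₁) :
    IsLeast {m | ∃ I : Finset (Fin n), RGHWAdmissible C₁ C₂ t I ∧ I.card = m}
      (rghw C₁ C₂ t) := by
  have hu : coordSubspace F (Finset.univ : Finset (Fin n)) = ⊤ := by
    ext x
    simp [coordSubspace]
  have hne : {m | ∃ I : Finset (Fin n), RGHWAdmissible C₁ C₂ t I ∧ I.card = m}.Nonempty := by
    refine ⟨_, Finset.univ, ?_, rfl⟩
    unfold RGHWAdmissible
    rw [hu, inf_top_eq, inf_top_eq]
    exact h
  exact ⟨Nat.sInf_mem hne, fun m hm => Nat.sInf_le hm⟩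

/-- The relative weights `d / n` that are reached at length `n`: there are a nested pair
`C₂ ⊆ C₁ ⊆ F ^ n` with `dim C₁ ≥ n R₁` and `dim C₂ ≤ n R₂`, and an index
`1 ≤ t ≤ dim C₁ - dim C₂` (the range in which `M_t(C₁, C₂)` is defined), such that `t ≤ T`
and `M_t(C₁, C₂) ≥ d`. -/
def achievable (F : Type*) [Field F] (n : ℕ) (T R₁ R₂ : ℝ) : Set EReal :=
  {x | ∃ (d t : ℕ) (C₁ C₂ : Submodule F (Fin n → F)),
    C₂ ≤ C₁ ∧
    1 ≤ t ∧ Module.finrank F C₂ + t ≤ Module.finrank F C₁ ∧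
    (t : ℝ) ≤ T ∧
    (n : ℝ) * R₁ ≤ (Module.finrank F C₁ : ℝ) ∧
    (Module.finrank F C₂ : ℝ) ≤ (n : ℝ) * R₂ ∧
    d ≤ rghw C₁ C₂ t ∧
    x = (((d : ℝ) / (n : ℝ) : ℝ) : EReal)}

/-- The asymptotic metric `δ_q(τ, R₁, R₂)`, where `q` is the cardinality of `F`: the limsup of
the largest relative weight reached at length `n` with leakage `t ≤ n τ`.
The set at length `n` is finite, so its supremum is its maximum if it is not empty; the
supremum of the empty set is `-∞` here. -/
noncomputable def delta (F : Type*) [Field F] (τ R₁ R₂ : ℝ) : EReal :=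
  Filter.limsup (fun n : ℕ => sSup (achievable F n ((n : ℝ) * τ) R₁ R₂)) Filter.atTop

/-- The same metric, with the index `t = 1` always allowed: the condition `t ≤ n τ` is read as
`t = 1` when `n τ < 1`, so that the metric is meaningful for `τ = 0` too. For `n τ ≥ 1`
nothing changes. -/
noncomputable def deltaOne (F : Type*) [Field F] (τ R₁ R₂ : ℝ) : EReal :=
  Filter.limsup (fun n : ℕ => sSup (achievable F n (max 1 ((n : ℝ) * τ)) R₁ R₂)) Filter.atTop

end RelGHW

/-!
Both limsups are limits, obtained by squeezing the largest relative weight at length `n`.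

*Upper bound.* The relative weights satisfy the Singleton bound
`M_t(C₁, C₂) ≤ n - dim C₁ + t` (`rghw_add_finrank_le`). Shrink the index set `I` one coordinate at
a time: the dimension of `C₁ ∩ V_I` drops by at most one at each step, and the deleted coordinate
can be chosen so that the dimension of `C₂ ∩ V_I` drops too as long as it is positive. After
`dim C₁ - t ≥ dim C₂` steps `C₂ ∩ V_I` is zero and `C₁ ∩ V_I` still has dimension at least `t`.

*Lower bound for `τ > 0`.* Take `C₂ = 0` and for `C₁` the kernel of an `r × n` matrix `H`. If
`C₁ ∩ V_I` has dimension at least `t` for a small set `I`, then some `t` columns of `H` lie in the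
span of a set `S` of at most `|I| - t` other columns. For given index sets this has probability at most
`q ^ (t * (|S| - r))`, and there are at most `4 ^ n` choices of the index sets, so a good `H` exists
if `t * (r - |S|) > 2 * n` (`exists_code_forall_lt_card`). As `t` is about `n * τ`, this costs only a
bounded number of coordinates compared with the Singleton bound.

*Lower bound for `τ = 0`, `R₁ = R₂`.* Take `C₂ = V_K` and `C₁ = V_K + ⟨(1, …, 1)⟩`. A vector of `C₁`
outside `C₂` has no zero coordinate outside `K`, so `M_1(C₁, C₂) ≥ n - |K|`, and `|K|` can be taken
to be about `n * R₁`.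
-/

namespace RelGHW

open Module Filter Topology

/-! ### Coordinate subspaces -/

section Coord

variable {F : Type*} [Field F] {n : ℕ}

theorem mem_coordSubspace {I : Finset (Fin n)} {x : Fin n → F} :
    x ∈ coordSubspace F I ↔ ∀ i, i ∉ I → x i = 0 := Iff.rfl

theorem coordSubspace_univ : coordSubspace F (Finset.univ : Finset (Fin n)) = ⊤ := by
  ext x
  simp [mem_coordSubspace]

theorem finrank_coordSubspace (I : Finset (Fin n)) : finrank F (coordSubspace F I) = I.card := by
  have h : coordSubspace F I =
      ⨅ i ∈ (↑I : Set (Fin n))ᶜ, LinearMap.ker (LinearMap.proj i : (Fin n → F) →ₗ[F] F) := by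
    ext x
    simp [mem_coordSubspace]
  rw [h, (LinearMap.iInfKerProjEquiv F (fun _ : Fin n => F) (I := (↑I : Set (Fin n)))
    disjoint_compl_right (by simp)).finrank_eq]
  simp

theorem coordSubspace_erase (I : Finset (Fin n)) (i : Fin n) :
    coordSubspace F (I.erase i) =
      coordSubspace F I ⊓ LinearMap.ker (LinearMap.proj i : (Fin n → F) →ₗ[F] F) := by
  ext x
  simp only [mem_coordSubspace, Submodule.mem_inf, LinearMap.mem_ker, LinearMap.proj_apply,
    Finset.mem_erase, not_and_or, not_not]
  constructor
  · exact fun h => ⟨fun j hj => h j (Or.inr hj), h i (Or.inl rfl)⟩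
  · rintro ⟨h, hi⟩ j (rfl | hj)
    · exact hi
    · exact h j hj

theorem finrank_inf_coordSubspace_le_erase (C : Submodule F (Fin n → F)) (I : Finset (Fin n))
    (i : Fin n) :
    finrank F ↥(C ⊓ coordSubspace F I) ≤ finrank F ↥(C ⊓ coordSubspace F (I.erase i)) + 1 := by
  rw [coordSubspace_erase, ← inf_assoc]
  set p := C ⊓ coordSubspace F I
  set k := LinearMap.ker (LinearMap.proj i : (Fin n → F) →ₗ[F] F) with hk
  have h1 := Submodule.finrank_sup_add_finrank_inf_eq p k
  have h2 : finrank F ↥(p ⊔ k) ≤ n := by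
    simpa using Submodule.finrank_le (p ⊔ k)
  have h3 := (LinearMap.proj i : (Fin n → F) →ₗ[F] F).finrank_range_add_finrank_ker
  have h4 := Submodule.finrank_le (LinearMap.range (LinearMap.proj i : (Fin n → F) →ₗ[F] F))
  simp only [finrank_self, finrank_fin_fun] at h3 h4
  rw [← hk] at h3
  omega

theorem finrank_inf_coordSubspace_erase_lt {C : Submodule F (Fin n → F)} {I : Finset (Fin n)}
    {i : Fin n} {x : Fin n → F} (hx : x ∈ C ⊓ coordSubspace F I) (hxi : x i ≠ 0) :
    finrank F ↥(C ⊓ coordSubspace F (I.erase i)) < finrank F ↥(C ⊓ coordSubspace F I) := by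
  apply Submodule.finrank_lt_finrank_of_lt
  rw [coordSubspace_erase, ← inf_assoc]
  refine lt_of_le_of_ne inf_le_left fun h => hxi ?_
  rw [← h] at hx
  exact hx.2

end Coord

/-! ### The Singleton bound -/

section Singleton

variable {F : Type*} [Field F] {n : ℕ}

/-- After the deletion of `j` suitable coordinates, `C₁` has lost at most `j` dimensions, and `C₂`
has lost `j` dimensions or has become trivial (the subtraction is truncated). -/
theorem exists_card_add_eq_and_finrank_inf (C₁ C₂ : Submodule F (Fin n → F)) (j : ℕ)
    (hj : j ≤ n) :
    ∃ I : Finset (Fin n), I.card + j = n ∧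
      finrank F C₁ ≤ finrank F ↥(C₁ ⊓ coordSubspace F I) + j ∧
      finrank F ↥(C₂ ⊓ coordSubspace F I) ≤ finrank F C₂ - j := by
  induction j with
  | zero =>
    refine ⟨Finset.univ, by simp, ?_, ?_⟩ <;> rw [coordSubspace_univ, inf_top_eq] <;> omega
  | succ j ih =>
    obtain ⟨I, hI, h1, h2⟩ := ih (by omega)
    by_cases hbot : C₂ ⊓ coordSubspace F I = ⊥
    · obtain ⟨i, hi⟩ : I.Nonempty := Finset.card_pos.mp (by omega)
      have hc := Finset.card_erase_add_one hi
      have := finrank_inf_coordSubspace_le_erase C₁ I i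
      refine ⟨I.erase i, by omega, by omega, ?_⟩
      have : C₂ ⊓ coordSubspace F (I.erase i) = ⊥ := by
        rw [coordSubspace_erase, ← inf_assoc, hbot, bot_inf_eq]
      rw [this, finrank_bot]
      exact Nat.zero_le _
    · obtain ⟨x, hx, hx0⟩ := Submodule.exists_mem_ne_zero_of_ne_bot hbot
      obtain ⟨i, hxi⟩ := Function.ne_iff.mp hx0
      have hi : i ∈ I := by
        by_contra hi
        exact hxi (hx.2 i hi)
      have hc := Finset.card_erase_add_one hi
      have := finrank_inf_coordSubspace_le_erase C₁ I i
      have := finrank_inf_coordSubspace_erase_lt hx hxi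
      exact ⟨I.erase i, by omega, by omega, by omega⟩

/-- The Singleton bound for relative generalized Hamming weights. -/
theorem rghw_add_finrank_le (C₁ C₂ : Submodule F (Fin n → F)) (t : ℕ)
    (h : finrank F C₂ + t ≤ finrank F C₁) :
    rghw C₁ C₂ t + finrank F C₁ ≤ n + t := by
  have hn : finrank F C₁ ≤ n := by simpa using Submodule.finrank_le C₁
  obtain ⟨I, hI, h1, h2⟩ :=
    exists_card_add_eq_and_finrank_inf C₁ C₂ (finrank F C₁ - t) (by omega)
  have := (rghw_isLeast C₁ C₂ t h).2 ⟨I, show _ + t ≤ _ by omega, rfl⟩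
  omega

end Singleton

/-! ### Codes from random parity check matrices -/

section Counting

variable {F : Type*} [Field F] {n : ℕ}

/-- A family `H` of vectors is read as the list of columns of a parity check matrix. If the code
that it defines has many words supported in `I`, then the columns in `I` are spanned by few of
them. -/
theorem exists_subset_spanning_columns {W : Type*} [AddCommGroup W] [Module F W]
    (H : Fin n → W) (I : Finset (Fin n)) :
    ∃ S ⊆ I,
      S.card + finrank F ↥(LinearMap.ker (Fintype.linearCombination F H) ⊓ coordSubspace F I)
        ≤ I.card ∧
      ∀ i ∈ I, H i ∈ Submodule.span F (H '' S) := by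
  classical
  obtain ⟨b, hbI, -, hsp, hli⟩ := exists_linearIndepOn_extension
    (linearIndepOn_empty F H) (Set.empty_subset (↑I : Set (Fin n)))
  obtain ⟨S, rfl⟩ : ∃ S : Finset (Fin n), (S : Set (Fin n)) = b := ⟨b.toFinset, by simp⟩
  refine ⟨S, by exact_mod_cast hbI, ?_, fun i hi => hsp ⟨i, hi, rfl⟩⟩
  set L := Fintype.linearCombination F H with hL
  set K := LinearMap.ker L ⊓ coordSubspace F I
  -- the kernel of `L` meets `V_S` trivially, so the two subspaces of `V_I` add up
  have hdisj : K ⊓ coordSubspace F S = ⊥ := by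
    rw [eq_bot_iff]
    rintro x ⟨⟨hx, -⟩, hxS⟩
    have hx' : ∑ i ∈ S, x i • H i = 0 := by
      have : ∑ i, x i • H i = 0 := hx
      rw [← this]
      exact Finset.sum_subset (Finset.subset_univ S) fun i _ hi => by simp [hxS i hi]
    have := linearIndepOn_finset_iff.mp hli x hx'
    rw [Submodule.mem_bot]
    ext i
    by_cases hi : i ∈ S
    · exact this i hi
    · exact hxS i hi
  have h1 := Submodule.finrank_sup_add_finrank_inf_eq K (coordSubspace F S)
  have h2 : K ⊔ coordSubspace F S ≤ coordSubspace F I :=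
    sup_le inf_le_right fun x hx i hi => hx i fun hS => hi (hbI hS)
  have h3 := Submodule.finrank_mono h2
  rw [hdisj, finrank_bot, finrank_coordSubspace] at h1
  rw [finrank_coordSubspace] at h3
  omega

/-- The families in which the vectors indexed by `J` are combinations of those indexed by `S` are
parametrized by the vectors outside `J` and the coefficients of the combinations. -/
theorem ncard_columns_in_span_le [Finite F] (r : ℕ) {S J : Finset (Fin n)} (hSJ : Disjoint S J) :
    {H : Fin n → Fin r → F | ∀ j ∈ J, H j ∈ Submodule.span F (H '' S)}.ncard ≤
      Nat.card F ^ (r * (n - J.card) + S.card * J.card) := by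
  classical
  let Φ : ({i // i ∉ J} → Fin r → F) × (J → S → F) → Fin n → Fin r → F := fun p i =>
    if h : i ∈ J then ∑ s : S, p.2 ⟨i, h⟩ s • p.1 ⟨s, Finset.disjoint_left.mp hSJ s.2⟩
    else p.1 ⟨i, h⟩
  have hsub : {H : Fin n → Fin r → F | ∀ j ∈ J, H j ∈ Submodule.span F (H '' S)} ⊆
      Set.range Φ := by
    intro H hH
    have hc : ∀ j : J, ∃ c : S → F, ∑ i, c i • H i = H j := fun j =>
      Submodule.mem_span_image_finset_iff_exists_fun F |>.mp (hH j j.2)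
    choose c hc using hc
    refine ⟨(fun i => H i, c), ?_⟩
    funext i
    by_cases h : i ∈ J
    · simp only [Φ, dif_pos h]
      exact hc ⟨i, h⟩
    · simp only [Φ, dif_neg h]
  refine (Set.ncard_le_ncard hsub (Set.toFinite _)).trans ?_
  rw [← Set.image_univ]
  refine (Set.ncard_image_le (Set.toFinite _)).trans (le_of_eq ?_)
  have hJ : Nat.card {i // i ∉ J} = n - J.card := by
    rw [Nat.card_eq_fintype_card, Fintype.card_subtype_compl]
    simp
  rw [Set.ncard_univ, Nat.card_prod, Nat.card_fun, Nat.card_fun, Nat.card_fun, Nat.card_fun, hJ]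
  simp only [Nat.card_eq_fintype_card (α := Fin r), Nat.card_eq_fintype_card (α := J),
    Nat.card_eq_fintype_card (α := S), Fintype.card_fin, Fintype.card_coe]
  rw [← pow_mul, ← pow_mul, ← pow_add]

/-- A code of codimension at most `r` whose `t`-th generalized Hamming weight exceeds `s + t`, by
the union bound over the index sets of `exists_subset_spanning_columns`. -/
theorem exists_code_forall_lt_card [Finite F] {r s t : ℕ} (ht : t ≤ n)
    (h : 2 * n + s * t < r * t) :
    ∃ C : Submodule F (Fin n → F), n ≤ finrank F C + r ∧
      ∀ I : Finset (Fin n), t ≤ finrank F ↥(C ⊓ coordSubspace F I) → s + t < I.card := by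
  classical
  have : Fintype F := Fintype.ofFinite F
  suffices hH : ∃ H : Fin n → Fin r → F, ∀ I : Finset (Fin n),
      t ≤ finrank F ↥(LinearMap.ker (Fintype.linearCombination F H) ⊓ coordSubspace F I) →
        s + t < I.card by
    obtain ⟨H, hH⟩ := hH
    refine ⟨_, ?_, hH⟩
    have h1 := (Fintype.linearCombination F H).finrank_range_add_finrank_ker
    have h2 := Submodule.finrank_le (LinearMap.range (Fintype.linearCombination F H))
    simp only [finrank_fin_fun] at h1 h2
    omega
  by_contra! hbad
  let P : Finset (Finset (Fin n) × Finset (Fin n)) :=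
    Finset.univ.filter fun p => Disjoint p.1 p.2 ∧ p.2.card = t ∧ p.1.card ≤ s
  let B : Finset (Fin n) × Finset (Fin n) → Finset (Fin n → Fin r → F) := fun p =>
    Finset.univ.filter fun H => ∀ j ∈ p.2, H j ∈ Submodule.span F (H '' p.1)
  have hcover : (Finset.univ : Finset (Fin n → Fin r → F)) ⊆ P.biUnion B := by
    intro H _
    obtain ⟨I, hI, hIs⟩ := hbad H
    obtain ⟨S, hSI, hS, hspan⟩ := exists_subset_spanning_columns (F := F) H I
    have hc := Finset.card_sdiff_add_card_eq_card hSI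
    obtain ⟨J, hJ, hJt⟩ := Finset.exists_subset_card_eq (show t ≤ (I \ S).card by omega)
    rw [Finset.mem_biUnion]
    refine ⟨(S, J), ?_, ?_⟩
    · simp only [P, Finset.mem_filter, Finset.mem_univ, true_and]
      exact ⟨Finset.disjoint_of_subset_right hJ Finset.disjoint_sdiff, hJt, by omega⟩
    · simp only [B, Finset.mem_filter, Finset.mem_univ, true_and]
      exact fun j hj => hspan j (Finset.mem_sdiff.mp (hJ hj)).1
  have hq : 2 ≤ Nat.card F := Finite.one_lt_card
  have hB : ∀ p ∈ P, (B p).card ≤ Nat.card F ^ (r * (n - t) + s * t) := by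
    rintro ⟨S, J⟩ hp
    simp only [P, Finset.mem_filter, Finset.mem_univ, true_and] at hp
    obtain ⟨hd, hJ, hS⟩ := hp
    have := ncard_columns_in_span_le (F := F) r hd
    rw [hJ] at this
    rw [← Set.ncard_coe_finset]
    simp only [B, Finset.coe_filter, Finset.mem_univ, true_and]
    exact this.trans (Nat.pow_le_pow_right (by omega) (by gcongr))
  have hP : P.card ≤ Nat.card F ^ (2 * n) := by
    refine (Finset.card_le_univ P).trans ?_
    rw [Fintype.card_prod, Fintype.card_finset, Fintype.card_fin, ← pow_add, ← two_mul]
    exact Nat.pow_le_pow_left hq _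
  have h1 := (Finset.card_le_card hcover).trans (Finset.card_biUnion_le_card_mul P B _ hB)
  have h2 : (Finset.univ : Finset (Fin n → Fin r → F)).card = Nat.card F ^ (r * n) := by
    rw [Finset.card_univ, Fintype.card_fun, Fintype.card_fun, Fintype.card_fin, Fintype.card_fin,
      ← pow_mul, Nat.card_eq_fintype_card]
  rw [h2] at h1
  have h3 : Nat.card F ^ (r * n) ≤ Nat.card F ^ (2 * n + (r * (n - t) + s * t)) := by
    rw [pow_add]
    exact h1.trans (Nat.mul_le_mul_right _ hP)
  have h4 := (Nat.pow_le_pow_iff_right hq).mp h3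
  have h5 : r * (n - t) + r * t = r * n := by rw [← mul_add, Nat.sub_add_cancel ht]
  omega

end Counting

/-! ### A coordinate subspace extended by the all-ones vector -/

section Ones

variable {F : Type*} [Field F] {n : ℕ}

theorem sub_card_le_rghw_sup_span_one (K : Finset (Fin n))
    (h : finrank F ↥(coordSubspace F K) + 1 ≤
      finrank F ↥(coordSubspace F K ⊔ Submodule.span F {(1 : Fin n → F)})) :
    n - K.card ≤ rghw (coordSubspace F K ⊔ Submodule.span F {(1 : Fin n → F)})
      (coordSubspace F K) 1 := by
  obtain ⟨I, hI, hc⟩ := (rghw_isLeast _ _ 1 h).1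
  rw [← hc]
  -- a word of the larger code outside `V_K` is supported in `I`, and it does not vanish off `K`
  obtain ⟨x, hx, hxK⟩ : ∃ x ∈ (coordSubspace F K ⊔ Submodule.span F {(1 : Fin n → F)}) ⊓
      coordSubspace F I, x ∉ coordSubspace F K := by
    by_contra! hcon
    have := Submodule.finrank_mono (le_inf hcon inf_le_right)
    unfold RGHWAdmissible at hI
    omega
  obtain ⟨y, hy, z, hz, rfl⟩ := Submodule.mem_sup.mp hx.1
  obtain ⟨c, rfl⟩ := Submodule.mem_span_singleton.mp hz
  have hc0 : c ≠ 0 := by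
    rintro rfl
    exact hxK (by simpa using hy)
  have hsub : Kᶜ ⊆ I := by
    intro i hi
    by_contra hiI
    have h1 := hx.2 i hiI
    have h2 := hy i (Finset.mem_compl.mp hi)
    simp [h2, hc0] at h1
  have := Finset.card_le_card hsub
  rwa [Finset.card_compl, Fintype.card_fin] at this

theorem finrank_sup_span_one {K : Finset (Fin n)} (hK : K.card < n) :
    finrank F ↥(coordSubspace F K ⊔ Submodule.span F {(1 : Fin n → F)}) = K.card + 1 := by
  obtain ⟨i, hi⟩ : ∃ i, i ∉ K := by
    by_contra! hall
    have := Finset.card_eq_iff_eq_univ K |>.mpr (Finset.eq_univ_of_forall hall)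
    simp at this
    omega
  rw [Submodule.finrank_sup_span_singleton, finrank_coordSubspace]
  exact fun h1 => one_ne_zero (α := F) (h1 i hi)

end Ones

/-! ### Asymptotics -/

section Asymptotics

variable {F : Type*} [Field F]

theorem achievable_mono {n : ℕ} {T T' R₁ R₂ : ℝ} (h : T ≤ T') :
    achievable F n T R₁ R₂ ⊆ achievable F n T' R₁ R₂ := by
  rintro x ⟨d, t, C₁, C₂, h1, h2, h3, h4, h5⟩
  exact ⟨d, t, C₁, C₂, h1, h2, h3, h4.trans h, h5⟩

theorem sSup_achievable_le {n : ℕ} (hn : 0 < n) {τ R₁ : ℝ} (hτ : 0 ≤ τ) (R₂ : ℝ) :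
    sSup (achievable F n (max 1 (n * τ)) R₁ R₂) ≤ ((1 + τ - R₁ + 1 / n : ℝ) : EReal) := by
  refine sSup_le ?_
  rintro x ⟨d, t, C₁, C₂, -, -, h3, h4, h5, -, h7, rfl⟩
  rw [EReal.coe_le_coe_iff]
  have hn' : (0 : ℝ) < n := by exact_mod_cast hn
  have h8 : (d : ℝ) + finrank F C₁ ≤ n + t := by
    exact_mod_cast (Nat.add_le_add_right h7 _).trans (rghw_add_finrank_le C₁ C₂ t h3)
  have h9 : (t : ℝ) ≤ 1 + n * τ := by
    have : 0 ≤ n * τ := by positivity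
    exact h4.trans (max_le (by linarith) (by linarith))
  rw [div_le_iff₀ hn']
  have : (1 + τ - R₁ + 1 / n) * (n : ℝ) = n + n * τ - n * R₁ + 1 := by
    field_simp
  linarith

/-- The constant `⌈4 / τ⌉ + 4` is the distance from the Singleton bound that the counting argument
loses, together with the rounding of `n * τ` and `n * R₁` to integers. -/
theorem le_sSup_achievable_of_pos [Finite F] {n : ℕ} {τ R₁ R₂ : ℝ} (hτ : 0 < τ) (hτR : τ ≤ R₁)
    (hR₁ : R₁ ≤ 1) (hR₂ : 0 ≤ R₂) (hn : 2 ≤ n * τ) :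
    ((1 + τ - R₁ - (⌈4 / τ⌉₊ + 4 : ℝ) / n : ℝ) : EReal) ≤
      sSup (achievable F n (n * τ) R₁ R₂) := by
  set c := ⌈4 / τ⌉₊ + 1 with hc
  set t := ⌊n * τ⌋₊ with ht
  set k := ⌈n * R₁⌉₊ with hk
  have hn0 : (0 : ℝ) < n := by
    by_contra! hneg
    nlinarith
  have htle : (t : ℝ) ≤ n * τ := Nat.floor_le (by linarith)
  have htlt : n * τ < t + 1 := Nat.lt_floor_add_one _
  have htR : n * τ ≤ n * R₁ := by gcongr
  have hkge : (n : ℝ) * R₁ ≤ k := Nat.le_ceil _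
  have hklt : (k : ℝ) < n * R₁ + 1 := Nat.ceil_lt_add_one (by linarith)
  have hkn : k ≤ n := Nat.ceil_le.mpr (by nlinarith)
  have ht1 : 1 ≤ t := by
    have : (0 : ℝ) < t := by linarith
    exact_mod_cast this
  have htk : t ≤ k := by exact_mod_cast htle.trans (htR.trans hkge)
  have hct : 2 * n < c * t := by
    have h1 : 4 / τ ≤ (⌈4 / τ⌉₊ : ℝ) := Nat.le_ceil _
    have h2 : (c : ℝ) = ⌈4 / τ⌉₊ + 1 := by simp [hc]
    have h3 : n * τ / 2 ≤ t := by linarith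
    have h4 : 4 / τ * (n * τ / 2) ≤ ⌈4 / τ⌉₊ * t := by gcongr
    have h5 : 4 / τ * (n * τ / 2) = 2 * n := by
      field_simp
      ring
    have h6 : (0 : ℝ) < t := by exact_mod_cast ht1
    have : (2 * n : ℝ) < c * t := by
      rw [h2]
      linarith
    exact_mod_cast this
  obtain ⟨C, hC, hCw⟩ : ∃ C : Submodule F (Fin n → F), k ≤ finrank F C ∧
      ∀ I : Finset (Fin n), t ≤ finrank F ↥(C ⊓ coordSubspace F I) →
        n + t ≤ I.card + k + c := by
    rcases le_total c (n - k) with hcr | hcr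
    · obtain ⟨s, hs⟩ := Nat.exists_eq_add_of_le hcr
      obtain ⟨C, h1, h2⟩ := exists_code_forall_lt_card (F := F) (n := n) (r := n - k) (s := s)
        (t := t) (htk.trans hkn) (by rw [hs, add_mul]; omega)
      refine ⟨C, by omega, fun I hI => ?_⟩
      have := h2 I hI
      omega
    -- the allowed loss covers the whole redundancy, and the trivial bound `t ≤ |I|` is enough
    · refine ⟨⊤, by simpa using hkn, fun I hI => ?_⟩
      rw [top_inf_eq, finrank_coordSubspace] at hI
      omega
  have hrank : finrank F (⊥ : Submodule F (Fin n → F)) + t ≤ finrank F C := by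
    rw [finrank_bot]
    omega
  obtain ⟨I, hI, hIc⟩ := (rghw_isLeast C ⊥ t hrank).1
  have hw : n + t ≤ rghw C ⊥ t + k + c := by
    rw [← hIc]
    refine hCw I ?_
    unfold RGHWAdmissible at hI
    omega
  refine le_trans ?_ (le_sSup ⟨rghw C ⊥ t, t, C, ⊥, bot_le, ht1, hrank, htle,
    hkge.trans (by exact_mod_cast hC), ?_, le_rfl, rfl⟩)
  · rw [EReal.coe_le_coe_iff, le_div_iff₀ hn0, sub_mul, div_mul_cancel₀ _ hn0.ne']
    have hw' : (n + t : ℝ) ≤ rghw C ⊥ t + k + (⌈4 / τ⌉₊ + 1) := by exact_mod_cast hw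
    linarith
  · rw [finrank_bot]
    simpa using mul_nonneg hn0.le hR₂

theorem le_sSup_achievable_one {n : ℕ} (hn : 0 < n) {R : ℝ} (hR : 0 ≤ R) (hR₁ : R ≤ 1) :
    ((1 - R : ℝ) : EReal) ≤ sSup (achievable F n 1 R R) := by
  have hn0 : (0 : ℝ) < n := by exact_mod_cast hn
  have hnR : (n : ℝ) * R ≤ n := by nlinarith
  have hfl : (⌊n * R⌋₊ : ℝ) ≤ n * R := Nat.floor_le (by positivity)
  have hlt : n * R < ⌊n * R⌋₊ + 1 := Nat.lt_floor_add_one _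
  -- the minimum with `n - 1` leaves room for the all-ones vector when `R = 1`
  obtain ⟨K, -, hK⟩ := Finset.exists_subset_card_eq
    (show min ⌊n * R⌋₊ (n - 1) ≤ (Finset.univ : Finset (Fin n)).card by simp)
  have hKn : K.card < n := by omega
  have hKle : (K.card : ℝ) ≤ n * R := le_trans (by exact_mod_cast hK.trans_le (min_le_left _ _)) hfl
  have hKge : n * R ≤ K.card + 1 := by
    rcases min_choice ⌊n * R⌋₊ (n - 1) with h | h
    · rw [hK, h]
      exact hlt.le
    · have : K.card + 1 = n := by omega
      refine hnR.trans ?_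
      exact_mod_cast this.ge
  have hr := finrank_sup_span_one (F := F) hKn
  have hr1 : finrank F ↥(coordSubspace F K) + 1 ≤
      finrank F ↥(coordSubspace F K ⊔ Submodule.span F {(1 : Fin n → F)}) := by
    rw [hr, finrank_coordSubspace]
  refine le_trans ?_ (le_sSup ⟨n - K.card, 1, _, coordSubspace F K, le_sup_left, le_rfl, hr1,
    by simp, ?_, ?_, sub_card_le_rghw_sup_span_one K hr1, rfl⟩)
  · rw [EReal.coe_le_coe_iff, le_div_iff₀ hn0, Nat.cast_sub hKn.le]
    linarith
  · rw [hr]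
    exact_mod_cast hKge
  · rwa [finrank_coordSubspace]

theorem limsup_eq_coe_of_squeeze {f : ℕ → EReal} {a c : ℝ}
    (hl : ∀ᶠ n : ℕ in atTop, ((a - c / n : ℝ) : EReal) ≤ f n)
    (hu : ∀ᶠ n : ℕ in atTop, f n ≤ ((a + 1 / n : ℝ) : EReal)) :
    limsup f atTop = (a : EReal) := by
  refine Tendsto.limsup_eq (tendsto_of_tendsto_of_tendsto_of_le_of_le' ?_ ?_ hl hu)
  · refine (continuous_coe_real_ereal.tendsto a).comp ?_
    simpa using tendsto_const_nhds.sub (tendsto_const_div_atTop_nhds_zero_nat c)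
  · refine (continuous_coe_real_ereal.tendsto a).comp ?_
    simpa using tendsto_const_nhds.add (tendsto_const_div_atTop_nhds_zero_nat (1 : ℝ))

end Asymptotics

end RelGHW

open RelGHW Filter in
theorem mainTheorem3 (F : Type*) [Field F] [Finite F] (τ R₁ R₂ : ℝ)
    (hτ : 0 ≤ τ) (hτR : τ ≤ R₁) (hR₁ : R₁ ≤ 1) (hR₂ : 0 ≤ R₂) :
    (0 < τ → RelGHW.delta F τ R₁ R₂ = ((1 + τ - R₁ : ℝ) : EReal)) ∧
    (0 < τ ∨ τ = R₁ - R₂ → RelGHW.deltaOne F τ R₁ R₂ = ((1 + τ - R₁ : ℝ) : EReal)) := by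
  have hmono : ∀ n : ℕ, sSup (achievable F n (n * τ) R₁ R₂) ≤
      sSup (achievable F n (max 1 (n * τ)) R₁ R₂) :=
    fun n => sSup_le_sSup (achievable_mono (le_max_right _ _))
  have hupper : ∀ᶠ n : ℕ in atTop, sSup (achievable F n (max 1 (n * τ)) R₁ R₂) ≤
      ((1 + τ - R₁ + 1 / n : ℝ) : EReal) := by
    filter_upwards [eventually_gt_atTop 0] with n hn
    exact sSup_achievable_le hn hτ R₂
  have hlower : 0 < τ → ∀ᶠ n : ℕ in atTop,
      ((1 + τ - R₁ - (⌈4 / τ⌉₊ + 4 : ℝ) / n : ℝ) : EReal) ≤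
        sSup (achievable F n (n * τ) R₁ R₂) := by
    intro hpos
    have hlarge : ∀ᶠ n : ℕ in atTop, 2 ≤ n * τ :=
      (tendsto_natCast_atTop_atTop.atTop_mul_const hpos).eventually_ge_atTop 2
    filter_upwards [hlarge] with n hn
    exact le_sSup_achievable_of_pos hpos hτR hR₁ hR₂ hn
  refine ⟨fun hpos => ?_, fun h => ?_⟩
  · exact limsup_eq_coe_of_squeeze (hlower hpos) (hupper.mono fun n hn => (hmono n).trans hn)
  · rcases hτ.lt_or_eq with hpos | rfl
    · exact limsup_eq_coe_of_squeeze ((hlower hpos).mono fun n hn => hn.trans (hmono n)) hupper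
    · obtain rfl : R₁ = R₂ := by
        rcases h with h | h
        · exact absurd h (lt_irrefl 0)
        · linarith
      refine limsup_eq_coe_of_squeeze (c := 0) ?_ hupper
      filter_upwards [eventually_gt_atTop 0] with n hn
      simpa using le_sSup_achievable_one (F := F) hn hR₂ hR₁
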